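/- Let $p$ be an odd prime, let $G=\mathrm{GL}_2(\mathbb F_p)$, let $B\le G$ be the subgroup of upper triangular matrices, and let $U_1$ (respectively $U_2$) be the subgroup of those matrices in $B$ whose lower right (respectively upper left) entry is a square in $\mathbb F_p^\times$. Let $\Theta=U_1-U_2$. For a finite-dimensional $\mathbb Q[G]$-representation $\rho$ on $V$, a pairing on $\rho$ is an $\mathbb R$-valued $\mathbb Q$-bilinear $G$-invariant form $\langle\cdot,\cdot\rangle$ on $V$ whose extension to $\mathbb R\otimes_{\mathbb Q}V$ is non-degenerate; pairings always exist. A formal sum $\sum_j n_jU_j$ of subgroups of $G$ with integer coefficients is a $G$-relation if $\bigoplus_{n_j>0}\mathbb Q[G/U_j]^{n_j}\cong\bigoplus_{n_j<0}\mathbb Q[G/U_j]^{-n_j}$, and the regulator constant of $\rho$ with respect to it, computed with a pairing $\langle\cdot,\cdot\rangle$, is $$\mathcal C_\Theta(\rho)=\prod_j\det\Bigl(\tfrac1{\#U_j}\langle\cdot,\cdot\rangle\big|V^{U_j}\Bigr)^{n_j}\in\mathbb R^\times/(\mathbb Q^\times)^2,$$ the determinants being taken with respect to arbitrary $\mathbb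 Q$-bases of the spaces $V^{U_j}$ of $U_j$-fixed vectors. Let $\chi$ be the quadratic character of $\mathbb F_p^\times$, let $r_{\chi,\mathbf 1}$ be the one-dimensional rational representation $\begin{pmatrix}a&b\\0&d\end{pmatrix}\mapsto\chi(a)$ of $B$, and let $I=\mathrm{Ind}_B^G\,r_{\chi,\mathbf 1}$ over $\mathbb Q$. Then $\Theta$ is a $G$-relation, and for every irreducible $\mathbb Q[G]$-representation $\rho$ and every pairing on $\rho$, $$\mathcal C_\Theta(\rho)\equiv p \pmod{(\mathbb Q^\times)^2}\ \text{ if }\rho\cong I,\qquad \mathcal C_\Theta(\rho)\equiv 1\pmod{(\mathbb Q^\times)^2}\ \text{ otherwise.}$$ -/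

import Mathlib

open scoped TensorProduct

noncomputable section

/-! ### Relations between permutation representations -/

section Relations

variable {G : Type*} [Group G]

/-- For a formal combination `m = ∑ m_U U` of subgroups with nonnegative coefficients (all of them
zero but for finitely many), the `G`-set consisting of `m_U` disjoint copies of `G ⧸ U` for
every subgroup `U`. -/
abbrev multiCoset (m : Subgroup G → ℕ) : Type _ := Σ U : Subgroup G, Σ _ : Fin (m U), G ⧸ U

/-- A formal sum `Θ = ∑ n_U U` of subgroups of `G` is a `G`-relation if the virtual permutation
representation `∑ n_U ℚ[G ⧸ U]` is zero, that is, if the permutation representation over `ℚ`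
of the positive part of `Θ` is isomorphic to that of the negative part of `Θ`. -/
def IsGRelation (Θ : Subgroup G →₀ ℤ) : Prop :=
  Nonempty ((Representation.ofMulAction ℚ G (multiCoset fun U => (Θ U).toNat)).Equiv
    (Representation.ofMulAction ℚ G (multiCoset fun U => (-Θ U).toNat)))

end Relations

/-! ### Regulator constants of rational representations -/

/-- The group `(ℚˣ)²` of nonzero rational squares, as a subgroup of `ℝˣ`. -/
def ratSquares : Subgroup ℝˣ :=
  (((Units.map (algebraMap ℚ ℝ : ℚ →* ℝ)).comp (powMonoidHom 2 : ℚˣ →* ℚˣ))).range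

section Regulator

variable {G : Type*} [Group G] {V : Type*} [AddCommGroup V] [Module ℚ V]

/-- A pairing on a rational representation: a real-valued, `ℚ`-bilinear, `G`-invariant and
non-degenerate form. Non-degeneracy is that of the real bilinear form on `ℝ ⊗ V`: the induced
`ℝ`-linear map `ℝ ⊗ V → Hom(V, ℝ)` is injective (hence bijective if `V` is
finite-dimensional). -/
structure InvariantPairing (ρ : Representation ℚ G V) where
  /-- the bilinear form -/
  form : V →ₗ[ℚ] V →ₗ[ℚ] ℝ
  invariant : ∀ (g : G) (x y : V), form (ρ g x) (ρ g y) = form x y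
  nondegenerate : Function.Injective (LinearMap.liftBaseChange ℝ form : ℝ ⊗[ℚ] V → (V →ₗ[ℚ] ℝ))

/-- The subspace `V ^ U` of vectors fixed by the subgroup `U`. -/
abbrev fixedSpace (ρ : Representation ℚ G V) (U : Subgroup G) : Submodule ℚ V :=
  Representation.invariants (ρ.comp U.subtype)

/-- The Gram matrix of the form `(1 / #U) ⟨·, ·⟩` on `V ^ U` with respect to a `ℚ`-basis. -/
def scaledGram {ρ : Representation ℚ G V} (B : InvariantPairing ρ) (U : Subgroup G)
    {ι : Type*} (b : Module.Basis ι ℚ (fixedSpace ρ U)) : Matrix ι ι ℝ :=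
  Matrix.of fun i j => (1 / (Nat.card U : ℝ)) * B.form (b i) (b j)

theorem scaledGram_det_ne_zero [Finite G] {ρ : Representation ℚ G V} (B : InvariantPairing ρ)
    (U : Subgroup G) {ι : Type*} [Fintype ι] [DecidableEq ι]
    (b : Module.Basis ι ℚ (fixedSpace ρ U)) : (scaledGram B U b).det ≠ 0 := by
  classical
  intro h0
  obtain ⟨v, hv, hvM⟩ := Matrix.exists_vecMul_eq_zero_iff.mpr h0
  have := Fintype.ofFinite U
  have hc : (Nat.card U : ℝ) ≠ 0 := Nat.cast_ne_zero.mpr Nat.card_pos.ne'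
  have hcQ : (Nat.card U : ℚ) ≠ 0 := Nat.cast_ne_zero.mpr Nat.card_pos.ne'
  -- pairing with fixed vectors vanishes
  have h1 : ∀ w : fixedSpace ρ U, ∑ i, v i * B.form (b i) w = 0 := by
    intro w
    have h2 : ∀ j, ∑ i, v i * B.form (b i) (b j) = 0 := by
      intro j
      have := congrFun hvM j
      simp only [Matrix.vecMul, dotProduct, scaledGram, Matrix.of_apply, Pi.zero_apply] at this
      have h3 : (1 / (Nat.card U : ℝ)) * ∑ i, v i * B.form (b i) (b j) = 0 := by
        rw [Finset.mul_sum, ← this]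
        exact Finset.sum_congr rfl fun i _ => by ring
      exact (mul_eq_zero.mp h3).resolve_left (one_div_ne_zero hc)
    rw [← b.sum_repr w]
    simp only [Submodule.coe_sum, Submodule.coe_smul, map_sum, map_smul, Finset.mul_sum]
    rw [Finset.sum_comm]
    refine Finset.sum_eq_zero fun j _ => ?_
    have : ∑ i, v i * (b.repr w j • B.form (b i) (b j))
        = b.repr w j • ∑ i, v i * B.form (b i) (b j) := by
      rw [Finset.smul_sum]
      exact Finset.sum_congr rfl fun i _ => by rw [mul_smul_comm]
    rw [this, h2, smul_zero]
  -- hence it vanishes with every vector, by averaging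
  have h4 : ∀ y : V, ∑ i, v i * B.form (b i) y = 0 := by
    intro y
    have hfix : (∑ u : U, ρ u y) ∈ fixedSpace ρ U := by
      intro g
      simp only [MonoidHom.comp_apply, Subgroup.coe_subtype, map_sum]
      refine Fintype.sum_equiv (Equiv.mulLeft g) _ _ fun u => ?_
      simp [map_mul]
    have h5 := h1 ⟨_, hfix⟩
    have h6 : ∀ i, B.form (b i) (∑ u : U, ρ u y) = (Nat.card U : ℝ) * B.form (b i) y := by
      intro i
      rw [map_sum]
      have : ∀ u : U, B.form (b i) (ρ u y) = B.form (b i) y := by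
        intro u
        have hb : ρ u (b i : V) = b i := (b i).2 u
        conv_lhs => rw [← hb]
        exact B.invariant _ _ _
      simp [this, Nat.card_eq_fintype_card]
    have h7 : (Nat.card U : ℝ) * ∑ i, v i * B.form (b i) y = 0 := by
      rw [← h5, Finset.mul_sum]
      refine Finset.sum_congr rfl fun i _ => ?_
      rw [h6]; ring
    exact (mul_eq_zero.mp h7).resolve_left hc
  have h8 : ∑ i, v i ⊗ₜ[ℚ] (b i : V) = 0 := by
    apply B.nondegenerate
    rw [map_zero, map_sum]
    ext y
    simpa [LinearMap.liftBaseChange_tmul] using h4 y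
  have h9 : ∑ i, v i ⊗ₜ[ℚ] b i = (0 : ℝ ⊗[ℚ] fixedSpace ρ U) := by
    apply Module.Flat.lTensor_preserves_injective_linearMap (M := ℝ) (fixedSpace ρ U).subtype
      (Submodule.injective_subtype _)
    simpa using h8
  have h10 : ∑ i, v i • (b.baseChange ℝ) i = 0 := by
    rw [← h9]
    exact Finset.sum_congr rfl fun i _ => by
      simp [Module.Basis.baseChange_apply, TensorProduct.smul_tmul']
  exact hv (funext (Fintype.linearIndependent_iff.mp (b.baseChange ℝ).linearIndependent v h10))

/-- The class of `det ((1 / #U) ⟨·, ·⟩ | V ^ U)` in `ℝˣ / (ℚˣ)²`, computed with respect to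
a given basis. -/
def regulatorClassOfBasis [Finite G] {ρ : Representation ℚ G V} (B : InvariantPairing ρ)
    (U : Subgroup G) {ι : Type*} [Fintype ι] [DecidableEq ι]
    (b : Module.Basis ι ℚ (fixedSpace ρ U)) : ℝˣ ⧸ ratSquares :=
  QuotientGroup.mk (Units.mk0 (scaledGram B U b).det (scaledGram_det_ne_zero B U b))

/-- The class does not depend on the basis. -/
theorem regulatorClassOfBasis_eq [Finite G] {ρ : Representation ℚ G V} (B : InvariantPairing ρ)
    (U : Subgroup G) {ι κ : Type*} [Fintype ι] [DecidableEq ι] [Fintype κ] [DecidableEq κ]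
    (b : Module.Basis ι ℚ (fixedSpace ρ U)) (c : Module.Basis κ ℚ (fixedSpace ρ U)) :
    regulatorClassOfBasis B U b = regulatorClassOfBasis B U c := by
  classical
  have e : κ ≃ ι := c.indexEquiv b
  have key : ∀ c' : Module.Basis ι ℚ (fixedSpace ρ U),
      regulatorClassOfBasis B U b = regulatorClassOfBasis B U c' := by
    intro c'
    set P : Matrix ι ι ℚ := b.toMatrix c' with hP
    have hdet : P.det ≠ 0 := by
      have := congrArg Matrix.det (b.toMatrix_mul_toMatrix_flip c')
      rw [Matrix.det_mul, Matrix.det_one] at this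
      exact left_ne_zero_of_mul_eq_one this
    have hM : scaledGram B U c' =
        (P.map (algebraMap ℚ ℝ)).transpose * scaledGram B U b * P.map (algebraMap ℚ ℝ) := by
      ext i j
      have hc : ∀ i, (c' i : V) = ∑ k, P k i • (b k : V) := by
        intro i
        have := congrArg Subtype.val (b.sum_toMatrix_smul_self c' i)
        rw [← this, hP, Submodule.coe_sum]
        rfl
      simp only [scaledGram, Matrix.of_apply, hc, Matrix.mul_apply, Matrix.transpose_apply,
        Matrix.map_apply, map_sum, map_smul, LinearMap.sum_apply, LinearMap.smul_apply,
        Finset.mul_sum, Finset.sum_mul, Algebra.smul_def]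
      refine Finset.sum_congr rfl fun k _ => Finset.sum_congr rfl fun l _ => ?_
      ring
    refine QuotientGroup.eq.mpr ⟨Units.mk0 P.det hdet, ?_⟩
    rw [eq_inv_mul_iff_mul_eq]
    ext
    simp only [MonoidHom.comp_apply, powMonoidHom_apply, Units.val_mul, Units.val_mk0,
      Units.coe_map, Units.val_pow_eq_pow_val, MonoidHom.coe_coe, hM, Matrix.det_mul,
      Matrix.det_transpose]
    have : (P.map (algebraMap ℚ ℝ)).det = algebraMap ℚ ℝ P.det :=
      ((algebraMap ℚ ℝ).map_det P).symm
    rw [this, map_pow]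
    ring
  rw [key (c.reindex e)]
  have : scaledGram B U c = (scaledGram B U (c.reindex e)).submatrix e e := by
    ext i j
    simp [scaledGram]
  unfold regulatorClassOfBasis
  congr 2
  rw [this, Matrix.det_submatrix_equiv_self]

/-- The class of `det ((1 / #U) ⟨·, ·⟩ | V ^ U)` in `ℝˣ / (ℚˣ)²`. -/
def regulatorClass [Finite G] [FiniteDimensional ℚ V] {ρ : Representation ℚ G V}
    (B : InvariantPairing ρ) (U : Subgroup G) : ℝˣ ⧸ ratSquares :=
  regulatorClassOfBasis B U (Module.finBasis ℚ (fixedSpace ρ U))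

/-- The regulator constant `∏ det ((1 / #U) ⟨·, ·⟩ | V ^ U) ^ n_U ∈ ℝˣ / (ℚˣ)²` of a rational
representation with respect to `Θ = ∑ n_U U`, computed with a given pairing. -/
def regulatorConstant [Finite G] [FiniteDimensional ℚ V] (Θ : Subgroup G →₀ ℤ)
    {ρ : Representation ℚ G V} (B : InvariantPairing ρ) : ℝˣ ⧸ ratSquares :=
  Θ.prod fun U n => regulatorClass B U ^ n

/-- Every finite-dimensional rational representation of a finite group carries a pairing. -/
theorem InvariantPairing.nonempty [Finite G] [FiniteDimensional ℚ V]
    (ρ : Representation ℚ G V) : Nonempty (InvariantPairing ρ) := by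
  classical
  have := Fintype.ofFinite G
  let b := Module.finBasis ℚ V
  let q : V →ₗ[ℚ] V →ₗ[ℚ] ℚ := ∑ g : G, ∑ k, LinearMap.mk₂ ℚ
    (fun x y => b.repr (ρ g x) k * b.repr (ρ g y) k)
    (by intros; simp [add_mul]) (by intros; simp [mul_assoc])
    (by intros; simp [mul_add]) (by intros; simp [mul_left_comm])
  have hq : ∀ x y, q x y = ∑ g : G, ∑ k, b.repr (ρ g x) k * b.repr (ρ g y) k := by
    intro x y; simp [q, LinearMap.sum_apply]
  let f : V →ₗ[ℚ] V →ₗ[ℚ] ℝ := q.compr₂ (Algebra.linearMap ℚ ℝ)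
  have hf : ∀ x y, f x y = ∑ g : G, ∑ k, (b.repr (ρ g x) k : ℝ) * (b.repr (ρ g y) k : ℝ) := by
    intro x y; simp [f, hq]
  refine ⟨⟨f, ?_, ?_⟩⟩
  · intro h x y
    rw [hf, hf]
    refine Fintype.sum_equiv (Equiv.mulRight h) _ _ fun g => ?_
    simp [map_mul]
  · rw [injective_iff_map_eq_zero]
    intro x hx
    have hxs := (b.baseChange ℝ).sum_repr x
    set v := (b.baseChange ℝ).repr x with hv
    have h1 : ∀ y, ∑ i, v i * f (b i) y = 0 := by
      intro y
      have := congrArg (fun l : V →ₗ[ℚ] ℝ => l y) hx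
      rw [← hxs] at this
      simpa [LinearMap.liftBaseChange_tmul, Module.Basis.baseChange_apply] using this
    have h2 : ∑ g : G, ∑ k, (∑ i, v i * (b.repr (ρ g (b i)) k : ℝ)) ^ 2 = 0 := by
      have h3 : ∑ j, v j * ∑ i, v i * f (b i) (b j) = 0 := by simp [h1]
      rw [← h3]
      simp only [hf, sq, Finset.sum_mul_sum]
      simp only [Finset.mul_sum]
      refine ((Finset.sum_congr rfl fun g _ => Finset.sum_comm).trans Finset.sum_comm).trans ?_
      refine Finset.sum_congr rfl fun i _ => ?_
      refine ((Finset.sum_congr rfl fun g _ => Finset.sum_comm).trans Finset.sum_comm).trans ?_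
      refine Finset.sum_congr rfl fun j _ => Finset.sum_congr rfl fun g _ =>
        Finset.sum_congr rfl fun k _ => ?_
      ring
    have h4 : ∀ k, v k = 0 := by
      intro k
      have h5 := (Finset.sum_eq_zero_iff_of_nonneg (fun g _ =>
        Finset.sum_nonneg fun k _ => sq_nonneg _)).mp h2 1 (Finset.mem_univ _)
      have h6 := (Finset.sum_eq_zero_iff_of_nonneg (fun k _ => sq_nonneg _)).mp h5 k
        (Finset.mem_univ _)
      have h7 := pow_eq_zero_iff (two_ne_zero) |>.mp h6
      simpa [Finsupp.single_apply, apply_ite] using h7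
    rw [← hxs]
    simp [h4]

end Regulator

/-! ### The group `GL₂(𝔽_p)`, its subgroups and the representation `I` -/

section GL2

open Matrix

variable (p : ℕ) [Fact p.Prime]

/-- `GL₂(𝔽_p)`. -/
abbrev GL2 : Type := GL (Fin 2) (ZMod p)

/-- The subgroup `B` of upper triangular matrices. -/
def upperBorel : Subgroup (GL2 p) where
  carrier := {g | g 1 0 = 0}
  one_mem' := by simp
  mul_mem' := by
    intro a b ha hb
    simp only [Set.mem_ofPred_eq] at ha hb ⊢
    simp [Matrix.mul_apply, Fin.sum_univ_two, ha, hb]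
  inv_mem' := by
    intro a ha
    simp only [Set.mem_ofPred_eq] at ha ⊢
    simp [Matrix.coe_units_inv, Matrix.inv_def, Matrix.adjugate_fin_two, ha]

variable {p}

theorem mem_upperBorel {g : GL2 p} : g ∈ upperBorel p ↔ g 1 0 = 0 := Iff.rfl

theorem borel_diag_mul {g : GL2 p} (hg : g ∈ upperBorel p) :
    g 0 0 * (g⁻¹ : GL2 p) 0 0 = 1 ∧ g 1 1 * (g⁻¹ : GL2 p) 1 1 = 1 := by
  have h1 := inv_mem hg
  rw [mem_upperBorel] at hg h1
  have h := congrArg (fun m : GL2 p => (m : Matrix (Fin 2) (Fin 2) (ZMod p))) (mul_inv_cancel g)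
  simp only [Units.val_mul, Units.val_one] at h
  have h00 := congrFun (congrFun h 0) 0
  have h11 := congrFun (congrFun h 1) 1
  simp only [Matrix.mul_apply, Fin.sum_univ_two, Matrix.one_apply_eq] at h00 h11
  rw [h1, mul_zero, add_zero] at h00
  rw [hg, zero_mul, zero_add] at h11
  exact ⟨h00, h11⟩

/-- The homomorphisms sending an upper triangular matrix to its `i`-th diagonal entry. -/
def borelDiag (i : Fin 2) : upperBorel p →* (ZMod p)ˣ :=
  MonoidHom.toHomUnits
    { toFun := fun g => (g : GL2 p) i i
      map_one' := by simp
      map_mul' := by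
        intro a b
        have ha := mem_upperBorel.mp a.2
        have hb := mem_upperBorel.mp b.2
        fin_cases i <;> simp [Matrix.mul_apply, Fin.sum_univ_two, ha, hb] }

theorem borelDiag_apply (i : Fin 2) (g : upperBorel p) :
    ((borelDiag i g : (ZMod p)ˣ) : ZMod p) = (g : GL2 p) i i := rfl

variable (p)

/-- The subgroup of upper triangular matrices whose `i`-th diagonal entry is a square. -/
def borelSquare (i : Fin 2) : Subgroup (GL2 p) where
  carrier := {g | g ∈ upperBorel p ∧ IsSquare (g i i)}
  one_mem' := ⟨one_mem _, by simp⟩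
  mul_mem' := by
    rintro a b ⟨ha, ha'⟩ ⟨hb, hb'⟩
    refine ⟨mul_mem ha hb, ?_⟩
    have : (a * b : GL2 p) i i = a i i * b i i := by
      have ha := mem_upperBorel.mp ha
      have hb := mem_upperBorel.mp hb
      fin_cases i <;> simp [Matrix.mul_apply, Fin.sum_univ_two, ha, hb]
    rw [this]
    exact ha'.mul hb'
  inv_mem' := by
    rintro a ⟨ha, ha'⟩
    refine ⟨inv_mem ha, ?_⟩
    have : (a⁻¹ : GL2 p) i i = (a i i)⁻¹ := by
      obtain ⟨h0, h1⟩ := borel_diag_mul ha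
      fin_cases i
      · exact eq_inv_of_mul_eq_one_right h0
      · exact eq_inv_of_mul_eq_one_right h1
    rw [this]
    exact ha'.inv

/-- `U₁`: upper triangular matrices with square lower right entry. -/
abbrev U1 : Subgroup (GL2 p) := borelSquare p 1

/-- `U₂`: upper triangular matrices with square upper left entry. -/
abbrev U2 : Subgroup (GL2 p) := borelSquare p 0

/-- The formal sum `Θ = U₁ - U₂`. -/
def gassmanTheta : Subgroup (GL2 p) →₀ ℤ :=
  Finsupp.single (U1 p) 1 - Finsupp.single (U2 p) 1

variable {p}

/-- The one-dimensional rational representation `r_{μ₁, μ₂}` of `B`, sending an upper triangular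
matrix with diagonal `(a, d)` to `μ₁ a * μ₂ d`. -/
def borelChar (μ₁ μ₂ : (ZMod p)ˣ →* ℚˣ) : Representation ℚ (upperBorel p) ℚ :=
  (Algebra.lmul ℚ ℚ : ℚ →* Module.End ℚ ℚ).comp
    ((Units.coeHom ℚ).comp (μ₁.comp (borelDiag 0) * μ₂.comp (borelDiag 1)))

theorem borelChar_apply (μ₁ μ₂ : (ZMod p)ˣ →* ℚˣ) (g : upperBorel p) (x : ℚ) :
    borelChar μ₁ μ₂ g x = (μ₁ (borelDiag 0 g) * μ₂ (borelDiag 1 g) : ℚ) * x := rfl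

variable (p)

/-- The quadratic character `χ` of `𝔽_pˣ`, with values in `ℚˣ`. -/
def quadChar : (ZMod p)ˣ →* ℚˣ :=
  ((quadraticChar (ZMod p)).ringHomComp (Int.castRingHom ℚ)).toUnitHom

/-- The representation `I = Ind_B^G r_{χ, 1}` over `ℚ`. -/
def principalI : Representation ℚ (GL2 p)
    (Representation.IndV (upperBorel p).subtype (borelChar (quadChar p) 1)) :=
  Representation.ind (upperBorel p).subtype (borelChar (quadChar p) 1)

/-- The class of `p` in `ℝˣ / (ℚˣ)²`. -/
def primeClass : ℝˣ ⧸ ratSquares :=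
  QuotientGroup.mk (Units.mk0 (p : ℝ) (Nat.cast_ne_zero.mpr (Fact.out : p.Prime).ne_zero))

end GL2

end

/-! Write `E i` for `quadEigen ρ i`, the space on which the Borel subgroup B acts through χ of the
i-th diagonal entry. Since `borelSquare p i` is the kernel in B of that quadratic character, its
fixed space is V^B ⊕ E i (`fixedEquiv`). A nonsquare scalar matrix acts by 1 on V^B and by -1 on E
i, so the sum is orthogonal for every pairing.

The two fixed spaces share V^B, and E 0 and E 1 are compared by the intertwining operator T = ∑
ρ(n(x) w), the sum running over unipotents n(x), with w the Weyl element. T exchanges E 0 and E 1,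
satisfies T² = p on both (`weylSum_weylSum`) and multiplies the pairing by p (`form_weylSum`). In
bases matched by T the two Gram matrices differ only by a factor p on the E block, so the regulator
constant is p ^ dim E 0 (`regulatorClass_eq_pow_mul`).

By Frobenius reciprocity E 0 is Hom_G(I, V). A Mackey argument shows that the E i part of a
representation generated by a vector of E i is a line (`borelProj_apply_mem_span`). It follows that,
for irreducible V, E 0 is a line if V ≅ I and zero otherwise.

The same T proves that Θ is a relation: it glues to the identity on the B-fixed part to give
mutually inverse maps between ℚ[G/U₁] and ℚ[G/U₂] (`coset_map_comp`). Comparing dimensions then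
gives #U₁ = #U₂. -/

noncomputable section

open Matrix

/-! ### Elements of `GL₂(𝔽_p)` -/

section Elements

variable {p : ℕ} [Fact p.Prime]

/-- The upper triangular matrix with diagonal `(a, d)` and upper right entry `c`. -/
def upperTri (a d : (ZMod p)ˣ) (c : ZMod p) : GL2 p :=
  GeneralLinearGroup.mkOfDetNeZero !![(a : ZMod p), c; 0, (d : ZMod p)]
    (by simp [det_fin_two])

/-- The unipotent matrix with upper right entry `x`. -/
def unip (x : ZMod p) : GL2 p := upperTri 1 1 x

/-- The Weyl element. -/
def weyl : GL2 p := GeneralLinearGroup.mkOfDetNeZero !![0, 1; 1, 0] (by simp [det_fin_two])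

theorem coe_upperTri (a d : (ZMod p)ˣ) (c : ZMod p) :
    (upperTri a d c : Matrix (Fin 2) (Fin 2) (ZMod p)) = !![(a : ZMod p), c; 0, (d : ZMod p)] := rfl

theorem coe_unip (x : ZMod p) :
    (unip x : Matrix (Fin 2) (Fin 2) (ZMod p)) = !![1, x; 0, 1] := rfl

theorem coe_weyl : (weyl (p := p) : Matrix (Fin 2) (Fin 2) (ZMod p)) = !![0, 1; 1, 0] := rfl

theorem upperTri_mem (a d : (ZMod p)ˣ) (c : ZMod p) : upperTri a d c ∈ upperBorel p := rfl

theorem unip_mem (x : ZMod p) : unip x ∈ upperBorel p := rfl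

theorem unip_mul (x y : ZMod p) : unip x * unip y = unip (x + y) := by
  ext i j
  rw [Units.val_mul, coe_unip, coe_unip, coe_unip]
  fin_cases i <;> fin_cases j <;> simp [Matrix.mul_apply, Fin.sum_univ_two, add_comm]

theorem unip_zero : unip (0 : ZMod p) = 1 := by
  ext i j
  rw [coe_unip, Units.val_one]
  fin_cases i <;> fin_cases j <;> simp

theorem unip_inv (x : ZMod p) : (unip x)⁻¹ = unip (-x) := by
  rw [inv_eq_iff_mul_eq_one, unip_mul, add_neg_cancel, unip_zero]

theorem weyl_mul_weyl : weyl * weyl = (1 : GL2 p) := by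
  ext i j
  rw [Units.val_mul, coe_weyl, Units.val_one]
  fin_cases i <;> fin_cases j <;> simp [Matrix.mul_apply, Fin.sum_univ_two]

theorem exists_eq_upperTri {g : GL2 p} (hg : g ∈ upperBorel p) :
    ∃ a d c, g = upperTri a d c := by
  refine ⟨borelDiag 0 ⟨g, hg⟩, borelDiag 1 ⟨g, hg⟩, g 0 1, ?_⟩
  ext i j
  rw [coe_upperTri, borelDiag_apply, borelDiag_apply]
  have := mem_upperBorel.mp hg
  fin_cases i <;> fin_cases j <;> simp [this]

/-- Moving a Borel element across n(x) w permutes the parameter x by an affine map and swaps the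
diagonal entries. -/
theorem upperTri_mul_unip_mul_weyl (a d : (ZMod p)ˣ) (c x : ZMod p) :
    upperTri a d c * (unip x * weyl) =
      unip ((a : ZMod p) * (d : ZMod p)⁻¹ * x + c * (d : ZMod p)⁻¹) * weyl * upperTri d a 0 := by
  ext i j
  simp only [Units.val_mul, coe_unip, coe_weyl, coe_upperTri]
  have : (d : ZMod p) ≠ 0 := d.ne_zero
  fin_cases i <;> fin_cases j <;>
    simp [Matrix.mul_apply, Fin.sum_univ_two, -Units.val_inv_eq_inv_val]
  rw [Units.val_inv_eq_inv_val]
  field_simp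

/-- The Bruhat decomposition of a lower unipotent matrix. -/
theorem weyl_mul_unip_mul_weyl (x : (ZMod p)ˣ) :
    weyl * (unip (x : ZMod p) * weyl) =
      unip (x : ZMod p)⁻¹ * (weyl * upperTri x (-x⁻¹) 1) := by
  ext i j
  simp only [Units.val_mul, coe_unip, coe_weyl, coe_upperTri, Units.val_neg,
    Units.val_inv_eq_inv_val]
  have : (x : ZMod p) ≠ 0 := x.ne_zero
  fin_cases i <;> fin_cases j <;>
    simp [Matrix.mul_apply, Fin.sum_univ_two, -Units.val_inv_eq_inv_val]

/-- Outside of the Borel subgroup, conjugation by `g` exchanges the diagonal entries of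
suitable upper triangular matrices. -/
theorem exists_upperTri_mul_eq {g : GL2 p} (hg : g ∉ upperBorel p) (a d : (ZMod p)ˣ) :
    ∃ c c', upperTri a d c * g = g * upperTri d a c' := by
  have h : g 1 0 ≠ 0 := hg
  refine ⟨g 0 0 / g 1 0 * (d - a), (d - a) * g 1 1 / g 1 0, ?_⟩
  ext i j
  simp only [Units.val_mul, coe_upperTri]
  fin_cases i <;> fin_cases j <;> simp [Matrix.mul_apply, Fin.sum_univ_two] <;> field_simp <;> ring

/-- The scalar matrices are central. -/
theorem upperTri_scalar_mul_comm (a : (ZMod p)ˣ) (g : GL2 p) :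
    upperTri a a 0 * g = g * upperTri a a 0 := by
  ext i j
  simp only [Units.val_mul, coe_upperTri]
  fin_cases i <;> fin_cases j <;> simp [Matrix.mul_apply, Fin.sum_univ_two, mul_comm]

theorem borel_mul_apply {g h : GL2 p} (hg : g ∈ upperBorel p) (hh : h ∈ upperBorel p) (i : Fin 2) :
    (g * h) i i = g i i * h i i := by
  have hg := mem_upperBorel.mp hg
  have hh := mem_upperBorel.mp hh
  fin_cases i <;> simp [Matrix.mul_apply, Fin.sum_univ_two, hg, hh]

theorem borel_diag_ne_zero {g : GL2 p} (hg : g ∈ upperBorel p) (i : Fin 2) : g i i ≠ 0 :=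
  (borelDiag i ⟨g, hg⟩).ne_zero

/-- The rational quadratic character of `𝔽_p`. -/
def chiQ (z : ZMod p) : ℚ := (quadraticChar (ZMod p) z : ℤ)

theorem chiQ_mul (x y : ZMod p) : chiQ (x * y) = chiQ x * chiQ y := by
  simp only [chiQ, map_mul, Int.cast_mul]

theorem chiQ_zero : chiQ (0 : ZMod p) = 0 := by simp [chiQ]

theorem chiQ_one : chiQ (1 : ZMod p) = 1 := by simp [chiQ]

theorem chiQ_mul_self {x : ZMod p} (hx : x ≠ 0) : chiQ x * chiQ x = 1 := by
  rw [chiQ, ← sq]; exact_mod_cast quadraticChar_sq_one hx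

theorem chiQ_eq_one_iff {x : ZMod p} (hx : x ≠ 0) : chiQ x = 1 ↔ IsSquare x := by
  rw [← quadraticChar_one_iff_isSquare hx, chiQ]; norm_cast

theorem chiQ_eq_neg_one {x : ZMod p} (hx : ¬ IsSquare x) : chiQ x = -1 := by
  have h0 : x ≠ 0 := fun h => hx (h ▸ IsSquare.zero)
  rcases mul_self_eq_one_iff.mp (chiQ_mul_self h0) with h | h
  · exact absurd ((chiQ_eq_one_iff h0).mp h) hx
  · exact h

theorem ringChar_ne_two (hp : p ≠ 2) : ringChar (ZMod p) ≠ 2 := by rwa [ZMod.ringChar_zmod_n]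

theorem sum_chiQ (hp : p ≠ 2) : ∑ x : ZMod p, chiQ x = 0 := by
  have := quadraticChar_sum_zero (F := ZMod p) (ringChar_ne_two hp)
  simp only [chiQ]
  exact_mod_cast this

theorem exists_unit_nonsquare (hp : p ≠ 2) : ∃ u : (ZMod p)ˣ, ¬ IsSquare (u : ZMod p) := by
  obtain ⟨u, hu⟩ := FiniteField.exists_nonsquare (F := ZMod p) (ringChar_ne_two hp)
  have h0 : u ≠ 0 := fun h => hu (h ▸ IsSquare.zero)
  exact ⟨Units.mk0 u h0, hu⟩

end Elements

/-! ### The eigenspaces of the Borel subgroup and the intertwining operator -/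

section Eigen

variable {p : ℕ} [Fact p.Prime] {V : Type*} [AddCommGroup V] [Module ℚ V]
  (ρ : Representation ℚ (GL2 p) V)

/-- The vectors on which the Borel subgroup acts through the quadratic character of the `i`-th
diagonal entry. -/
def quadEigen (i : Fin 2) : Submodule ℚ V where
  carrier := {v | ∀ g ∈ upperBorel p, ρ g v = chiQ (g i i) • v}
  zero_mem' := by simp
  add_mem' := by
    intro v w hv hw g hg
    rw [map_add, hv g hg, hw g hg, smul_add]
  smul_mem' := by
    intro c v hv g hg
    rw [map_smul, hv g hg, smul_comm]

/-- The standard intertwining operator. -/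
def weylSum : V →ₗ[ℚ] V := ∑ x : ZMod p, ρ (unip x * weyl)

variable {ρ}

theorem weylSum_apply (v : V) : weylSum ρ v = ∑ x : ZMod p, ρ (unip x * weyl) v := by
  simp [weylSum, LinearMap.sum_apply]

/-- By `upperTri_mul_unip_mul_weyl`, a Borel element permutes the summands and hits v with the
swapped diagonal, which turns the index i into j. -/
theorem weylSum_mem {i j : Fin 2} (hij : i ≠ j) {v : V} (hv : v ∈ quadEigen ρ i) :
    weylSum ρ v ∈ quadEigen ρ j := by
  intro g hg
  obtain ⟨a, d, c, rfl⟩ := exists_eq_upperTri hg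
  have hd : (d : ZMod p) ≠ 0 := d.ne_zero
  have ha : (a : ZMod p) ≠ 0 := a.ne_zero
  rw [weylSum_apply, map_sum, Finset.smul_sum]
  let e : ZMod p ≃ ZMod p :=
    (Equiv.mulLeft₀ ((a : ZMod p) * (d : ZMod p)⁻¹) (mul_ne_zero ha (inv_ne_zero hd))).trans
      (Equiv.addRight (c * (d : ZMod p)⁻¹))
  refine Fintype.sum_equiv e _ _ fun x => ?_
  have h1 : ρ (upperTri d a 0) v = chiQ ((upperTri a d c : GL2 p) j j) • v := by
    rw [hv _ (upperTri_mem d a 0), coe_upperTri, coe_upperTri]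
    fin_cases i <;> fin_cases j <;> simp_all
  rw [← Module.End.mul_apply, ← map_mul, upperTri_mul_unip_mul_weyl, map_mul ρ _ (upperTri d a 0),
    Module.End.mul_apply, h1, map_smul]
  rfl

theorem unip_apply_of_mem {i : Fin 2} {v : V} (hv : v ∈ quadEigen ρ i) (x : ZMod p) :
    ρ (unip x) v = v := by
  rw [hv _ (unip_mem x), coe_unip]
  fin_cases i <;> simp [chiQ_one]

theorem sum_unip_unip (x : ZMod p) (v : V) :
    ∑ y : ZMod p, ρ (unip y) (ρ (unip x) v) = ∑ y : ZMod p, ρ (unip y) v := by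
  refine Fintype.sum_equiv (Equiv.addRight x) _ _ fun y => ?_
  rw [← Module.End.mul_apply, ← map_mul, unip_mul]
  rfl

/-- In the double sum over n(y) w n(x) w, the term x = 0 gives n(y) v = v, hence p • v in total. For
x ≠ 0 the Bruhat decomposition gives χ(±x^±1) times T v after summing over y, and these signs cancel
because χ has sum zero. -/
theorem weylSum_weylSum (hp : p ≠ 2) {i : Fin 2} {v : V} (hv : v ∈ quadEigen ρ i) :
    weylSum ρ (weylSum ρ v) = (p : ℚ) • v := by
  -- The i-th diagonal entry of the Borel factor in `weyl_mul_unip_mul_weyl`. At x = 0 it is 0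
  -- because `0⁻¹ = 0`, so that term adds nothing to the character sum.
  let c : ZMod p → ZMod p := fun x => ![x, -x⁻¹] i
  have hc0 : c 0 = 0 := by fin_cases i <;> simp [c]
  have hcsum : ∑ x, chiQ (c x) = 0 := by
    rw [← sum_chiQ hp]
    fin_cases i
    · rfl
    · exact Fintype.sum_equiv ((Equiv.inv (ZMod p)).trans (Equiv.neg _)) _ _ fun x => rfl
  have hw : ∀ u : V, weylSum ρ u = ∑ y : ZMod p, ρ (unip y) (ρ weyl u) := by
    intro u; simp [weylSum_apply]
  have key : ∀ x : ZMod p, ∑ y : ZMod p, ρ (unip y) (ρ weyl (ρ (unip x * weyl) v)) =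
      chiQ (c x) • weylSum ρ v + if x = 0 then (p : ℚ) • v else 0 := by
    intro x
    by_cases hx : x = 0
    · subst hx
      have : ρ weyl (ρ (unip 0 * weyl) v) = v := by
        rw [unip_zero, one_mul, ← Module.End.mul_apply, ← map_mul, weyl_mul_weyl, map_one]
        rfl
      simp only [this, unip_apply_of_mem hv, hc0, chiQ_zero, zero_smul, zero_add, if_true,
        Finset.sum_const, Finset.card_univ, ZMod.card, Nat.cast_smul_eq_nsmul]
    · have h2 : ρ weyl (ρ (unip x * weyl) v) = chiQ (c x) • ρ (unip x⁻¹) (ρ weyl v) := by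
        have h3 := weyl_mul_unip_mul_weyl (Units.mk0 x hx)
        rw [Units.val_mk0] at h3
        rw [← Module.End.mul_apply, ← map_mul, h3, map_mul, map_mul, Module.End.mul_apply,
          Module.End.mul_apply, hv _ (upperTri_mem _ _ _), map_smul, map_smul, coe_upperTri]
        congr 2
        fin_cases i <;> simp [c]
      simp only [h2, map_smul, ← Finset.smul_sum, sum_unip_unip, hx, if_false, add_zero,
        hw v]
  rw [hw, weylSum_apply]
  simp only [map_sum]
  rw [Finset.sum_comm]
  simp only [key, Finset.sum_add_distrib, ← Finset.sum_smul, hcsum, zero_smul, zero_add,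
    Finset.sum_ite_eq', Finset.mem_univ, if_true]

/-- The intertwining operator exchanges the two eigenspaces. -/
def weylEquiv (hp : p ≠ 2) {i j : Fin 2} (hij : i ≠ j) : quadEigen ρ i ≃ₗ[ℚ] quadEigen ρ j :=
  have hp0 : (p : ℚ) ≠ 0 := Nat.cast_ne_zero.mpr (Fact.out : p.Prime).ne_zero
  LinearEquiv.ofLinearMap
    ((weylSum ρ).restrict fun _ hv => weylSum_mem hij hv)
    ((p : ℚ)⁻¹ • (weylSum ρ).restrict fun _ hv => weylSum_mem hij.symm hv)
    (by
      ext v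
      simp [LinearMap.restrict_apply, weylSum_weylSum hp v.2, smul_smul, inv_mul_cancel₀ hp0])
    (by
      ext v
      simp [LinearMap.restrict_apply, weylSum_weylSum hp v.2, smul_smul, inv_mul_cancel₀ hp0])

theorem coe_weylEquiv (hp : p ≠ 2) {i j : Fin 2} (hij : i ≠ j) (v : quadEigen ρ i) :
    (weylEquiv hp hij v : V) = weylSum ρ v := rfl

theorem InvariantPairing.form_apply_left {G : Type*} [Group G] {σ : Representation ℚ G V}
    (B : InvariantPairing σ) (g : G) (x y : V) : B.form (σ g x) y = B.form x (σ g⁻¹ y) := by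
  rw [← B.invariant g x, ← Module.End.mul_apply, ← map_mul, mul_inv_cancel, map_one]
  rfl

/-- Both ⟨T v, u⟩ and ⟨v, T u⟩ equal p ⟨v, w u⟩ when v ∈ E i and u ∈ E j, since the unipotents fix v
and u. So T is self-adjoint between the eigenspaces, and T² = p finishes. -/
theorem form_weylSum (hp : p ≠ 2) (B : InvariantPairing ρ) {i j : Fin 2} (hij : i ≠ j) {v w : V}
    (hv : v ∈ quadEigen ρ i) (hw : w ∈ quadEigen ρ i) :
    B.form (weylSum ρ v) (weylSum ρ w) = p * B.form v w := by
  have weyl_inv : (weyl : GL2 p)⁻¹ = weyl := inv_eq_of_mul_eq_one_right weyl_mul_weyl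
  have h1 : ∀ u ∈ quadEigen ρ j, B.form (weylSum ρ v) u = p * B.form v (ρ weyl u) := by
    intro u hu
    rw [weylSum_apply, map_sum, LinearMap.sum_apply]
    simp [InvariantPairing.form_apply_left, weyl_inv, unip_inv, unip_apply_of_mem hu, ZMod.card]
  have h2 : ∀ u, B.form v (weylSum ρ u) = p * B.form v (ρ weyl u) := by
    intro u
    have : ∀ x : ZMod p, B.form v (ρ (unip x) (ρ weyl u)) = B.form v (ρ weyl u) := by
      intro x
      conv_lhs => rw [← unip_apply_of_mem hv x]
      exact B.invariant _ _ _
    rw [weylSum_apply, map_sum]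
    simp [this, ZMod.card]
  rw [h1 _ (weylSum_mem hij hw), ← h2, weylSum_weylSum hp hw, map_smul, Algebra.smul_def]
  simp

end Eigen

/-! ### Vectors fixed by `U₁` and `U₂` -/

section Fixed

variable {p : ℕ} [Fact p.Prime] {V : Type*} [AddCommGroup V] [Module ℚ V]
  {ρ : Representation ℚ (GL2 p) V}

theorem mem_fixedSpace {G : Type*} [Group G] {σ : Representation ℚ G V} {U : Subgroup G} {v : V} :
    v ∈ fixedSpace σ U ↔ ∀ g ∈ U, σ g v = v :=
  ⟨fun h g hg => h ⟨g, hg⟩, fun h g => h g.1 g.2⟩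

theorem mem_borelSquare {i : Fin 2} {g : GL2 p} :
    g ∈ borelSquare p i ↔ g ∈ upperBorel p ∧ chiQ (g i i) = 1 := by
  constructor
  · rintro ⟨h, h'⟩
    exact ⟨h, (chiQ_eq_one_iff (borel_diag_ne_zero h i)).mpr h'⟩
  · rintro ⟨h, h'⟩
    exact ⟨h, (chiQ_eq_one_iff (borel_diag_ne_zero h i)).mp h'⟩

theorem fixedSpace_borel_le (i : Fin 2) :
    fixedSpace ρ (upperBorel p) ≤ fixedSpace ρ (borelSquare p i) := by
  intro v hv
  rw [mem_fixedSpace] at hv ⊢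
  exact fun g hg => hv g hg.1

theorem quadEigen_le (i : Fin 2) : quadEigen ρ i ≤ fixedSpace ρ (borelSquare p i) := by
  intro v hv
  rw [mem_fixedSpace]
  intro g hg
  rw [mem_borelSquare] at hg
  rw [hv g hg.1, hg.2, one_smul]

theorem scalar_apply_of_mem_quadEigen {i : Fin 2} {v : V} (hv : v ∈ quadEigen ρ i) {s : (ZMod p)ˣ}
    (hs : ¬ IsSquare (s : ZMod p)) : ρ (upperTri s s 0) v = -v := by
  have : (upperTri s s 0 : GL2 p) i i = s := by
    rw [coe_upperTri]; fin_cases i <;> rfl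
  rw [hv _ (upperTri_mem _ _ _), this, chiQ_eq_neg_one hs, neg_one_smul]

/-- An upper triangular matrix acts on a `U_i`-fixed vector `v` and on its translate by a
nonsquare scalar either trivially, or by exchanging them. -/
theorem borel_apply_of_mem_fixedSpace {i : Fin 2} {v : V} (hv : v ∈ fixedSpace ρ (borelSquare p i))
    {s : (ZMod p)ˣ} (hs : ¬ IsSquare (s : ZMod p)) {g : GL2 p} (hg : g ∈ upperBorel p) :
    (chiQ (g i i) = 1 ∧ ρ g v = v ∧ ρ g (ρ (upperTri s s 0) v) = ρ (upperTri s s 0) v) ∨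
    (chiQ (g i i) = -1 ∧ ρ g v = ρ (upperTri s s 0) v ∧ ρ g (ρ (upperTri s s 0) v) = v) := by
  rw [mem_fixedSpace] at hv
  set z : GL2 p := upperTri s s 0 with hz
  have hzB : z ∈ upperBorel p := upperTri_mem _ _ _
  have hzc : chiQ (z i i) = -1 := by
    rw [← chiQ_eq_neg_one hs, hz, coe_upperTri]; fin_cases i <;> rfl
  have hcomm : ∀ h : GL2 p, z * h = h * z := upperTri_scalar_mul_comm s
  rcases mul_self_eq_one_iff.mp (chiQ_mul_self (borel_diag_ne_zero hg i)) with h | h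
  · have h1 : ρ g v = v := hv g (mem_borelSquare.mpr ⟨hg, h⟩)
    refine Or.inl ⟨h, h1, ?_⟩
    rw [← Module.End.mul_apply, ← map_mul, ← hcomm, map_mul, Module.End.mul_apply, h1]
  -- If χ of the diagonal entry is -1, both g z and g z⁻¹ lie in U_i; since z is central, they give
  -- g z v = v and g v = z v.
  · have h1 : ρ (g * z) v = v := by
      refine hv _ (mem_borelSquare.mpr ⟨mul_mem hg hzB, ?_⟩)
      rw [borel_mul_apply hg hzB, chiQ_mul, h, hzc]; norm_num
    have h2 : ρ (g * z⁻¹) v = v := by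
      refine hv _ (mem_borelSquare.mpr ⟨mul_mem hg (inv_mem hzB), ?_⟩)
      have h3 : chiQ (z⁻¹ i i) = -1 := by
        have h4 : chiQ ((z * z⁻¹) i i) = 1 := by
          rw [mul_inv_cancel, Units.val_one, Matrix.one_apply_eq, chiQ_one]
        rw [borel_mul_apply hzB (inv_mem hzB), chiQ_mul, hzc] at h4
        linarith
      rw [borel_mul_apply hg (inv_mem hzB), chiQ_mul, h, h3]; norm_num
    refine Or.inr ⟨h, ?_, ?_⟩
    · conv_lhs => rw [show g = z * (g * z⁻¹) by rw [← mul_assoc, hcomm, mul_inv_cancel_right]]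
      rw [map_mul, Module.End.mul_apply, h2]
    · rw [← Module.End.mul_apply, ← map_mul, h1]

theorem add_scalar_mem {i : Fin 2} {v : V} (hv : v ∈ fixedSpace ρ (borelSquare p i))
    {s : (ZMod p)ˣ} (hs : ¬ IsSquare (s : ZMod p)) :
    v + ρ (upperTri s s 0) v ∈ fixedSpace ρ (upperBorel p) := by
  rw [mem_fixedSpace]
  intro g hg
  rcases borel_apply_of_mem_fixedSpace hv hs hg with ⟨-, h1, h2⟩ | ⟨-, h1, h2⟩
  · rw [map_add, h1, h2]
  · rw [map_add, h1, h2, add_comm]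

theorem sub_scalar_mem {i : Fin 2} {v : V} (hv : v ∈ fixedSpace ρ (borelSquare p i))
    {s : (ZMod p)ˣ} (hs : ¬ IsSquare (s : ZMod p)) :
    v - ρ (upperTri s s 0) v ∈ quadEigen ρ i := by
  intro g hg
  rcases borel_apply_of_mem_fixedSpace hv hs hg with ⟨h0, h1, h2⟩ | ⟨h0, h1, h2⟩
  · rw [map_sub, h1, h2, h0, one_smul]
  · rw [map_sub, h1, h2, h0, neg_one_smul, neg_sub]

variable (ρ) in
/-- The vectors fixed by `U_i` are sums of vectors fixed by the Borel subgroup and of vectors on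
which it acts through the quadratic character. -/
def fixedEquiv (hp : p ≠ 2) (i : Fin 2) :
    (fixedSpace ρ (upperBorel p) × quadEigen ρ i) ≃ₗ[ℚ] fixedSpace ρ (borelSquare p i) :=
  LinearEquiv.ofBijective
    ((Submodule.inclusion (fixedSpace_borel_le i)).coprod (Submodule.inclusion (quadEigen_le i)))
    (by
      -- The scalar s acts by 1 on V^B and by -1 on the eigenspace: its two eigenprojections, (v ± s
      -- v) / 2, give the splitting.
      obtain ⟨s, hs⟩ := exists_unit_nonsquare hp
      constructor
      · rw [injective_iff_map_eq_zero]
        rintro ⟨x, y⟩ h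
        have h1 : (x : V) + y = 0 := congrArg Subtype.val h
        have hx : ρ (upperTri s s 0) (x : V) = x := mem_fixedSpace.mp x.2 _ (upperTri_mem _ _ _)
        have h2 := congrArg (ρ (upperTri s s 0)) h1
        rw [map_add, scalar_apply_of_mem_quadEigen y.2 hs, hx, map_zero, ← sub_eq_add_neg,
          sub_eq_zero] at h2
        have hy : (y : V) = 0 := by
          rw [h2, ← two_smul ℚ] at h1
          exact (smul_eq_zero.mp h1).resolve_left two_ne_zero
        ext
        · simp [h2, hy]
        · simp [hy]
      · intro v
        refine ⟨((1 / 2 : ℚ) • ⟨_, add_scalar_mem v.2 hs⟩, (1 / 2 : ℚ) • ⟨_, sub_scalar_mem v.2 hs⟩),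
          ?_⟩
        ext
        simp only [LinearMap.coprod_apply, map_smul, Submodule.coe_add, Submodule.coe_smul,
          Submodule.coe_inclusion]
        module)

theorem coe_fixedEquiv (hp : p ≠ 2) (i : Fin 2)
    (x : fixedSpace ρ (upperBorel p) × quadEigen ρ i) :
    (fixedEquiv ρ hp i x : V) = x.1 + x.2 := rfl

/-- A nonsquare scalar fixes x and negates y, so invariance makes the pairing equal to its negative.
-/
theorem form_fixed_quadEigen_eq_zero (hp : p ≠ 2) (B : InvariantPairing ρ) {i : Fin 2} {x y : V}
    (hx : x ∈ fixedSpace ρ (upperBorel p)) (hy : y ∈ quadEigen ρ i) :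
    B.form x y = 0 ∧ B.form y x = 0 := by
  obtain ⟨s, hs⟩ := exists_unit_nonsquare hp
  have h1 := B.invariant (upperTri s s 0) x y
  have h2 := B.invariant (upperTri s s 0) y x
  rw [scalar_apply_of_mem_quadEigen hy hs, mem_fixedSpace.mp hx _ (upperTri_mem _ _ _)] at h1 h2
  simp only [map_neg, LinearMap.neg_apply] at h1 h2
  constructor <;> linarith

/-- The bases are adapted to V^B ⊕ E i and V^B ⊕ E j, with the basis of E j the image under T of
that of E i. Both Gram matrices are block diagonal, and only the second block changes, by the factor
p. -/
theorem regulatorClass_eq_pow_mul (hp : p ≠ 2) [FiniteDimensional ℚ V] (B : InvariantPairing ρ)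
    {i j : Fin 2} (hij : i ≠ j) (hcard : Nat.card (borelSquare p i) = Nat.card (borelSquare p j)) :
    regulatorClass B (borelSquare p j) =
      primeClass p ^ Module.finrank ℚ (quadEigen ρ i) * regulatorClass B (borelSquare p i) := by
  classical
  let b0 := Module.finBasis ℚ (fixedSpace ρ (upperBorel p))
  let b1 := Module.finBasis ℚ (quadEigen ρ i)
  let bi := (b0.prod b1).map (fixedEquiv ρ hp i)
  let bj := (b0.prod (b1.map (weylEquiv hp hij))).map (fixedEquiv ρ hp j)
  rw [regulatorClass, regulatorClass, regulatorClassOfBasis_eq B _ _ bi,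
    regulatorClassOfBasis_eq B _ _ bj]
  let c : ℝ := 1 / (Nat.card (borelSquare p i) : ℝ)
  let A : Matrix _ _ ℝ := Matrix.of fun k l => c * B.form (b0 k) (b0 l)
  let D : Matrix _ _ ℝ := Matrix.of fun k l => c * B.form (b1 k) (b1 l)
  have hi : scaledGram B _ bi = fromBlocks A 0 0 D := by
    ext k l
    rcases k with k | k <;> rcases l with l | l <;>
      simp [scaledGram, bi, A, D, c, coe_fixedEquiv,
        (form_fixed_quadEigen_eq_zero hp B (b0 _).2 (b1 _).2).1,
        (form_fixed_quadEigen_eq_zero hp B (b0 _).2 (b1 _).2).2]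
  have hj : scaledGram B _ bj = fromBlocks A 0 0 ((p : ℝ) • D) := by
    ext k l
    rcases k with k | k <;> rcases l with l | l
    · simp [scaledGram, bj, A, c, coe_fixedEquiv, hcard, -Nat.card_eq_fintype_card]
    · simp [scaledGram, bj, coe_fixedEquiv,
        (form_fixed_quadEigen_eq_zero hp B (b0 _).2 (weylEquiv hp hij (b1 _)).2).1]
    · simp [scaledGram, bj, coe_fixedEquiv,
        (form_fixed_quadEigen_eq_zero hp B (b0 _).2 (weylEquiv hp hij (b1 _)).2).2]
    · simp only [scaledGram, bj, D, c, coe_fixedEquiv, coe_weylEquiv, hcard, of_apply,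
        fromBlocks_apply₂₂, Module.Basis.map_apply, Module.Basis.prod_apply_inr_fst,
        Module.Basis.prod_apply_inr_snd, Submodule.coe_zero, zero_add, Matrix.smul_apply,
        smul_eq_mul, form_weylSum hp B hij (b1 _).2 (b1 _).2]
      ring
  have hdet : (scaledGram B _ bj).det =
      (p : ℝ) ^ Module.finrank ℚ (quadEigen ρ i) * (scaledGram B _ bi).det := by
    rw [hi, hj, det_fromBlocks_zero₂₁, det_fromBlocks_zero₂₁, det_smul, Fintype.card_fin]
    ring
  rw [regulatorClassOfBasis, regulatorClassOfBasis, primeClass, ← QuotientGroup.mk_pow,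
    ← QuotientGroup.mk_mul]
  congr 1
  ext
  simp [hdet]

end Fixed

/-! ### Multiplicity one -/

section MultiplicityOne

variable {p : ℕ} [Fact p.Prime] {V : Type*} [AddCommGroup V] [Module ℚ V]
  {ρ : Representation ℚ (GL2 p) V}

instance : Fintype (upperBorel p) := Fintype.ofFinite _

variable (ρ) in
/-- The projection to the eigenspace, multiplied by the order of the Borel subgroup. -/
def borelProj (i : Fin 2) : V →ₗ[ℚ] V :=
  ∑ g : upperBorel p, chiQ ((g : GL2 p) i i) • ρ (g : GL2 p)

theorem borelProj_apply (i : Fin 2) (v : V) :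
    borelProj ρ i v = ∑ g : upperBorel p, chiQ ((g : GL2 p) i i) • ρ (g : GL2 p) v := by
  simp [borelProj, LinearMap.sum_apply]

theorem borelProj_borel_apply {i : Fin 2} {h : GL2 p} (hh : h ∈ upperBorel p) (v : V) :
    borelProj ρ i (ρ h v) = chiQ (h i i) • borelProj ρ i v := by
  rw [borelProj_apply, borelProj_apply, Finset.smul_sum]
  refine Fintype.sum_equiv (Equiv.mulRight ⟨h, hh⟩) _ _ fun g => ?_
  have h1 := chiQ_mul_self (borel_diag_ne_zero hh i)
  rw [Equiv.coe_mulRight, Subgroup.coe_mul, borel_mul_apply g.2 hh, chiQ_mul, smul_smul, map_mul,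
    Module.End.mul_apply, mul_left_comm, h1, mul_one]

theorem borelProj_of_mem {i : Fin 2} {v : V} (hv : v ∈ quadEigen ρ i) :
    borelProj ρ i v = (Nat.card (upperBorel p) : ℚ) • v := by
  rw [borelProj_apply]
  have h : ∀ g : upperBorel p, chiQ ((g : GL2 p) i i) • ρ (g : GL2 p) v = v := by
    intro g
    rw [hv g g.2, smul_smul, chiQ_mul_self (borel_diag_ne_zero g.2 i), one_smul]
  simp only [h, Finset.sum_const, Finset.card_univ, Nat.card_eq_fintype_card,
    Nat.cast_smul_eq_nsmul]

/-- The translates of an eigenvector project to multiples of it. -/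
theorem borelProj_apply_mem_span (hp : p ≠ 2) {i : Fin 2} {v : V} (hv : v ∈ quadEigen ρ i)
    (g : GL2 p) : borelProj ρ i (ρ g v) ∈ Submodule.span ℚ {v} := by
  by_cases hg : g ∈ upperBorel p
  · rw [borelProj_borel_apply hg, borelProj_of_mem hv]
    exact Submodule.smul_mem _ _ (Submodule.smul_mem _ _ (Submodule.mem_span_singleton_self v))
  · obtain ⟨s, hs⟩ := exists_unit_nonsquare hp
    -- Off the Borel subgroup, g intertwines diagonals (1, s) and (s, 1), on which χ of the i-th
    -- entry takes opposite signs. The projection of ρ g v then equals its own negative.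
    obtain ⟨c, c', hc⟩ := exists_upperTri_mul_eq hg 1 s
    have h1 : borelProj ρ i (ρ (upperTri 1 s c * g) v) =
        borelProj ρ i (ρ (g * upperTri s 1 c') v) := by rw [hc]
    rw [map_mul, map_mul, Module.End.mul_apply, Module.End.mul_apply,
      borelProj_borel_apply (upperTri_mem _ _ _), hv _ (upperTri_mem _ _ _), map_smul, map_smul,
      ← sub_eq_zero, ← sub_smul] at h1
    have h2 : chiQ ((upperTri 1 s c : GL2 p) i i) - chiQ ((upperTri s 1 c' : GL2 p) i i) ≠ 0 := by
      rw [coe_upperTri, coe_upperTri]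
      fin_cases i <;> norm_num [chiQ_one, chiQ_eq_neg_one hs]
    rw [(smul_eq_zero.mp h1).resolve_left h2]
    exact zero_mem _

/-- A vector is cyclic if its translates span the representation. -/
def IsCyclicVector {G : Type*} [Group G] (σ : Representation ℚ G V) (v : V) : Prop :=
  Submodule.span ℚ (Set.range fun g => σ g v) = ⊤

theorem IsCyclicVector.finiteDimensional {G : Type*} [Group G] [Finite G]
    {σ : Representation ℚ G V} {v : V} (h : IsCyclicVector σ v) : FiniteDimensional ℚ V := by
  have := FiniteDimensional.span_of_finite ℚ (Set.finite_range fun g => σ g v)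
  rw [h] at this
  exact Module.finite_def.mpr (Module.Finite.iff_fg.mp this)

theorem isCyclicVector_of_isIrreducible {G : Type*} [Group G] {σ : Representation ℚ G V}
    (hσ : σ.IsIrreducible) {v : V} (hv : v ≠ 0) : IsCyclicVector σ v := by
  let S : Subrepresentation σ :=
    { toSubmodule := Submodule.span ℚ (Set.range fun g => σ g v)
      apply_mem_toSubmodule := by
        intro g w hw
        induction hw using Submodule.span_induction with
        | mem x hx =>
          obtain ⟨h, rfl⟩ := hx
          refine Submodule.subset_span ⟨g * h, ?_⟩
          simp
        | zero => simp
        | add x y _ _ hx hy => rw [map_add]; exact add_mem hx hy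
        | smul c x _ hx => rw [map_smul]; exact Submodule.smul_mem _ _ hx }
  have hvS : v ∈ S.toSubmodule := Submodule.subset_span ⟨1, by simp⟩
  rcases hσ.eq_bot_or_eq_top S with h | h
  · rw [h] at hvS
    exact absurd ((Submodule.mem_bot ℚ).mp hvS) hv
  · exact congrArg Subrepresentation.toSubmodule h

theorem borelProj_mem_span (hp : p ≠ 2) {i : Fin 2} {v : V} (hv : v ∈ quadEigen ρ i)
    (hc : IsCyclicVector ρ v) (x : V) : borelProj ρ i x ∈ Submodule.span ℚ {v} := by
  have hx : x ∈ Submodule.span ℚ (Set.range fun g => ρ g v) := by rw [hc]; trivial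
  have hle : Submodule.span ℚ (Set.range fun g => ρ g v) ≤
      (Submodule.span ℚ {v}).comap (borelProj ρ i) := by
    rw [Submodule.span_le]
    rintro _ ⟨g, rfl⟩
    exact borelProj_apply_mem_span hp hv g
  exact hle hx

theorem card_upperBorel_ne_zero : (Nat.card (upperBorel p) : ℚ) ≠ 0 :=
  Nat.cast_ne_zero.mpr Nat.card_pos.ne'

/-- The projection is a nonzero scalar on the eigenspace, and its values lie on the line of the
cyclic vector. -/
theorem quadEigen_eq_span (hp : p ≠ 2) {i : Fin 2} {v : V} (hv : v ∈ quadEigen ρ i)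
    (hc : IsCyclicVector ρ v) : quadEigen ρ i = Submodule.span ℚ {v} := by
  apply le_antisymm
  · intro u hu
    have h := borelProj_mem_span hp hv hc u
    rw [borelProj_of_mem hu] at h
    exact (Submodule.smul_mem_iff _ card_upperBorel_ne_zero).mp h
  · rw [Submodule.span_le]
    simpa using hv

/-- Non-degeneracy is stated over ℝ; it descends because V embeds in ℝ ⊗ V by faithful flatness. -/
theorem InvariantPairing.eq_zero_of_forall {G : Type*} [Group G] {σ : Representation ℚ G V}
    (B : InvariantPairing σ) {x : V} (h : ∀ y, B.form x y = 0) : x = 0 := by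
  have h1 : (1 : ℝ) ⊗ₜ[ℚ] x = 0 := by
    apply B.nondegenerate
    rw [map_zero]
    ext y
    simp [LinearMap.liftBaseChange_tmul, h]
  have h2 := Module.FaithfullyFlat.tensorProduct_mk_injective (A := ℚ) (B := ℝ) V
  apply h2
  simpa using h1

/-- If f x = 0, the projection of any translate of x is a multiple c • v with c • f v = 0, so it
vanishes. The projection is self-adjoint up to its normalization, hence x is orthogonal to all
translates of v, that is, to everything. -/
theorem injective_of_isCyclicVector (hp : p ≠ 2) {W : Type*} [AddCommGroup W] [Module ℚ W]
    {σ : Representation ℚ (GL2 p) W} {i : Fin 2} {v : V} (hv : v ∈ quadEigen ρ i)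
    (hc : IsCyclicVector ρ v) (f : V →ₗ[ℚ] W) (hf : ∀ g x, f (ρ g x) = σ g (f x))
    (hfv : f v ≠ 0) : Function.Injective f := by
  have := hc.finiteDimensional
  obtain ⟨B⟩ := InvariantPairing.nonempty ρ
  have hP : ∀ x, f (borelProj ρ i x) = borelProj σ i (f x) := by
    intro x
    simp [borelProj_apply, hf]
  have hadj : ∀ x, B.form (borelProj ρ i x) v = (Nat.card (upperBorel p) : ℝ) * B.form x v := by
    intro x
    have h : ∀ g : upperBorel p,
        chiQ ((g : GL2 p) i i) • B.form (ρ (g : GL2 p) x) v = B.form x v := by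
      intro g
      have h1 := hv g g.2
      have h2 : v = chiQ ((g : GL2 p) i i) • ρ (g : GL2 p) v := by
        rw [h1, smul_smul, chiQ_mul_self (borel_diag_ne_zero g.2 i), one_smul]
      conv_lhs => rw [h2, map_smul, smul_smul, chiQ_mul_self (borel_diag_ne_zero g.2 i), one_smul]
      exact B.invariant _ _ _
    rw [borelProj_apply, map_sum, LinearMap.sum_apply]
    simp only [map_smul, LinearMap.smul_apply, h, Finset.sum_const, Finset.card_univ,
      Nat.card_eq_fintype_card, nsmul_eq_mul]
  rw [injective_iff_map_eq_zero]
  intro x hx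
  have h1 : ∀ g, B.form x (ρ g v) = 0 := by
    intro g
    obtain ⟨c, hcv⟩ := Submodule.mem_span_singleton.mp (borelProj_mem_span hp hv hc (ρ g⁻¹ x))
    have h2 : c • f v = 0 := by
      rw [← map_smul, hcv, hP, hf, hx, map_zero, map_zero]
    rw [(smul_eq_zero.mp h2).resolve_right hfv, zero_smul] at hcv
    have h3 := hadj (ρ g⁻¹ x)
    rw [← hcv, map_zero, LinearMap.zero_apply, B.form_apply_left, inv_inv] at h3
    exact (mul_eq_zero.mp h3.symm).resolve_left (Nat.cast_ne_zero.mpr Nat.card_pos.ne')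
  apply B.eq_zero_of_forall
  intro y
  have hle : Submodule.span ℚ (Set.range fun g => ρ g v) ≤ LinearMap.ker (B.form x) := by
    rw [Submodule.span_le]
    rintro _ ⟨g, rfl⟩
    exact h1 g
  rw [hc] at hle
  exact hle trivial

end MultiplicityOne

/-! ### The induced representation -/

section Induced

open Representation

variable {p : ℕ} [Fact p.Prime] {V : Type*} [AddCommGroup V] [Module ℚ V]
  {ρ : Representation ℚ (GL2 p) V}

variable (p) in
/-- The canonical generator of the induced representation. -/
def indGen : IndV (upperBorel p).subtype (borelChar (quadChar p) 1) :=
  IndV.mk (upperBorel p).subtype (borelChar (quadChar p) 1) 1 1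

theorem principalI_indGen (g : GL2 p) :
    principalI p g (indGen p) =
      IndV.mk (upperBorel p).subtype (borelChar (quadChar p) 1) g⁻¹ 1 := by
  rw [principalI, indGen, ind_mk, one_mul]

theorem indGen_mem : indGen p ∈ quadEigen (principalI p) 0 := by
  intro g hg
  have h1 : borelChar (quadChar p) 1 ⟨g, hg⟩ (1 : ℚ) = chiQ (g 0 0) := by
    rw [borelChar_apply]
    simp [quadChar, chiQ, borelDiag_apply]
  -- The defining relation of the coinvariants at g⁻¹ ⊗ 1: the element g carries it to 1 ⊗ χ(g).
  have h2 := Coinvariants.mk_self_apply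
    (Representation.tprod ((leftRegular ℚ (GL2 p)).comp (upperBorel p).subtype)
      (borelChar (quadChar p) 1))
    ⟨g, hg⟩ (MonoidAlgebra.single (g⁻¹ : GL2 p) (1 : ℚ) ⊗ₜ[ℚ] (1 : ℚ))
  rw [principalI_indGen, indGen, ← map_smul, smul_eq_mul, mul_one, ← h1]
  refine h2.symm.trans ?_
  simp [ofMulAction_single]

theorem isCyclicVector_indGen : IsCyclicVector (principalI p) (indGen p) := by
  rw [IsCyclicVector, ← Submodule.ker_mkQ (Submodule.span ℚ _), LinearMap.ker_eq_top]
  apply IndV.hom_ext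
  intro h
  ext
  simp only [LinearMap.comp_apply, LinearMap.zero_apply]
  rw [← LinearMap.mem_ker, Submodule.ker_mkQ]
  refine Submodule.subset_span ⟨h⁻¹, ?_⟩
  dsimp only
  rw [principalI_indGen, inv_inv]
  rfl

/-- Frobenius reciprocity: a vector in the eigenspace extends to a map from the induced
representation. -/
theorem exists_indGen_map {v : V} (hv : v ∈ quadEigen ρ 0) :
    ∃ f : IndV (upperBorel p).subtype (borelChar (quadChar p) 1) →ₗ[ℚ] V,
      (∀ g x, f (principalI p g x) = ρ g (f x)) ∧ f (indGen p) = v := by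
  -- `IndV.mk h 1` is the translate of the generator by h⁻¹, so its image has to be ρ h⁻¹ v. The
  -- eigenvector condition on v makes this descend to the coinvariants.
  refine ⟨Coinvariants.lift _
    (TensorProduct.lift <| (Finsupp.lift _ _ _ fun h : GL2 p =>
      ρ h⁻¹ ∘ₗ LinearMap.toSpanSingleton ℚ V v) ∘ₗ
      (MonoidAlgebra.coeffLinearEquiv ℚ).toLinearMap) ?_, ?_, ?_⟩
  · intro g
    have h1 : borelChar (quadChar p) 1 g (1 : ℚ) = chiQ ((g : GL2 p) 0 0) := by
      rw [borelChar_apply]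
      simp [quadChar, chiQ, borelDiag_apply]
    ext h
    simp [ofMulAction_single, h1, ← hv g g.2, ← Module.End.mul_apply, ← map_mul]
  · intro g x
    rw [← LinearMap.comp_apply, ← LinearMap.comp_apply]
    congr 1
    ext h
    simp [principalI]
  · simp [indGen]

/-- An isomorphism carries the generator of I into E 0. Conversely, a nonzero vector of E 0 defines
a map from I that is injective by `injective_of_isCyclicVector` and surjective because ρ is
irreducible. -/
theorem nonempty_equiv_principalI_iff (hp : p ≠ 2) (hρ : ρ.IsIrreducible) :
    Nonempty (ρ.Equiv (principalI p)) ↔ quadEigen ρ 0 ≠ ⊥ := by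
  constructor
  · rintro ⟨φ⟩ h
    have h1 : φ.toLinearEquiv.symm (indGen p) ∈ quadEigen ρ 0 := by
      intro g hg
      apply φ.toLinearEquiv.injective
      have := IntertwiningMap.isIntertwining _ _ φ.toIntertwiningMap g
        (φ.toLinearEquiv.symm (indGen p))
      have h2 : ∀ x, φ.toLinearEquiv x = φ.toIntertwiningMap x := fun _ => rfl
      rw [h2, this, ← h2, LinearEquiv.apply_symm_apply, map_smul, LinearEquiv.apply_symm_apply]
      exact indGen_mem g hg
    rw [h, Submodule.mem_bot, LinearEquiv.map_eq_zero_iff] at h1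
    have h3 := isCyclicVector_indGen (p := p)
    rw [IsCyclicVector, h1] at h3
    simp only [map_zero, Set.range_const, Submodule.span_zero_singleton] at h3
    have h4 : ∀ x : V, x = 0 := by
      intro x
      apply φ.toLinearEquiv.injective
      rw [map_zero, ← Submodule.mem_bot ℚ, h3]
      trivial
    exact bot_ne_top (α := Subrepresentation ρ) (Subrepresentation.toSubmodule_injective
      (le_antisymm bot_le fun x _ => (Submodule.mem_bot ℚ).mpr (h4 x)))
  · intro h
    obtain ⟨v, hv, hv0⟩ := (Submodule.ne_bot_iff _).mp h
    obtain ⟨f, hf, hfv⟩ := exists_indGen_map hv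
    have hinj := injective_of_isCyclicVector hp indGen_mem isCyclicVector_indGen f hf
      (hfv ▸ hv0)
    have hsurj : Function.Surjective f := by
      rw [← LinearMap.range_eq_top, eq_top_iff, ← isCyclicVector_of_isIrreducible hρ hv0,
        Submodule.span_le]
      rintro _ ⟨g, rfl⟩
      exact ⟨principalI p g (indGen p), by rw [hf, hfv]⟩
    let e := LinearEquiv.ofBijective f ⟨hinj, hsurj⟩
    exact ⟨(Representation.Equiv.mk (ρ := principalI p) (σ := ρ) e
      fun g => LinearMap.ext fun x => hf g x).symm⟩

theorem finrank_quadEigen_zero (hp : p ≠ 2) (hρ : ρ.IsIrreducible) (h : quadEigen ρ 0 ≠ ⊥) :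
    Module.finrank ℚ (quadEigen ρ 0) = 1 := by
  obtain ⟨v, hv, hv0⟩ := (Submodule.ne_bot_iff _).mp h
  rw [quadEigen_eq_span hp hv (isCyclicVector_of_isIrreducible hρ hv0)]
  exact finrank_span_singleton hv0

end Induced

/-! ### The relation between permutation representations -/

section Relation

open Representation

/-! ### Coset representations of an arbitrary group -/

section Coset

variable {G : Type*} [Group G] {V : Type*} [AddCommGroup V] [Module ℚ V]

/-- The class of the base point in a coset representation. -/
def cosetGen (U : Subgroup G) : MonoidAlgebra ℚ (G ⧸ U) :=
  MonoidAlgebra.single ((1 : G) : G ⧸ U) 1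

theorem ofMulAction_cosetGen (U : Subgroup G) (g : G) :
    ofMulAction ℚ G (G ⧸ U) g (cosetGen U) = MonoidAlgebra.single (g : G ⧸ U) 1 := by
  rw [cosetGen, ofMulAction_single]
  congr 1
  simp

theorem cosetGen_mem (U : Subgroup G) :
    cosetGen U ∈ fixedSpace (ofMulAction ℚ G (G ⧸ U)) U := by
  rw [mem_fixedSpace]
  intro g hg
  rw [ofMulAction_cosetGen, cosetGen]
  congr 1
  exact (QuotientGroup.eq.mpr (by simpa using hg)).symm

/-- A vector fixed by `U` extends to a map from the coset representation. -/
theorem exists_cosetGen_map (ρ : Representation ℚ G V) {U : Subgroup G} {v : V}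
    (hv : v ∈ fixedSpace ρ U) :
    ∃ f : MonoidAlgebra ℚ (G ⧸ U) →ₗ[ℚ] V,
      (∀ g x, f (ofMulAction ℚ G (G ⧸ U) g x) = ρ g (f x)) ∧ f (cosetGen U) = v := by
  let a : G ⧸ U → V := Quotient.lift (fun g => ρ g v) (by
    intro g h hgh
    have h1 : ρ (g⁻¹ * h) v = v := mem_fixedSpace.mp hv _ (QuotientGroup.leftRel_apply.mp hgh)
    rw [← h1, ← Module.End.mul_apply, ← map_mul, mul_inv_cancel_left, h1])
  let f : MonoidAlgebra ℚ (G ⧸ U) →ₗ[ℚ] V :=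
    (Finsupp.lift V ℚ (G ⧸ U) a) ∘ₗ (MonoidAlgebra.coeffLinearEquiv ℚ).toLinearMap
  have hf : ∀ x, f (MonoidAlgebra.single x 1) = a x := by
    intro x
    simp [f]
  refine ⟨f, ?_, ?_⟩
  · intro g x
    rw [← LinearMap.comp_apply, ← LinearMap.comp_apply]
    congr 1
    apply MonoidAlgebra.lhom_ext'
    intro x
    ext
    simp only [LinearMap.comp_apply, MonoidAlgebra.lsingle_apply, ofMulAction_single, hf]
    induction x using QuotientGroup.induction_on with
    | H h => exact congrArg (fun r => r v) (map_mul ρ g h)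
  · rw [cosetGen, hf]
    change ρ 1 v = v
    simp

theorem eq_id_of_cosetGen {U : Subgroup G}
    (f : MonoidAlgebra ℚ (G ⧸ U) →ₗ[ℚ] MonoidAlgebra ℚ (G ⧸ U))
    (hf : ∀ g x, f (ofMulAction ℚ G (G ⧸ U) g x) = ofMulAction ℚ G (G ⧸ U) g (f x))
    (h1 : f (cosetGen U) = cosetGen U) : f = LinearMap.id := by
  apply MonoidAlgebra.lhom_ext'
  intro x
  induction x using QuotientGroup.induction_on with
  | H h =>
    ext1
    simp only [LinearMap.comp_apply, MonoidAlgebra.lsingle_apply, LinearMap.id_apply]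
    rw [← ofMulAction_cosetGen, hf, h1]

/-- An equivariant bijection induces an equivalence of permutation representations. -/
def ofMulActionEquiv {X Y : Type*} [MulAction G X] [MulAction G Y] (e : X ≃ Y)
    (he : ∀ (g : G) x, e (g • x) = g • e x) :
    (ofMulAction ℚ G X).Equiv (ofMulAction ℚ G Y) :=
  .mk (MonoidAlgebra.mapDomainLinearEquiv ℚ ℚ e) fun g => by
    apply MonoidAlgebra.lhom_ext'
    intro x
    ext1
    simp [ofMulAction_single, he]

/-- The `G`-set of a formal combination consisting of one subgroup. -/
def multiCosetEquiv {m : Subgroup G → ℕ} {U : Subgroup G} (h1 : m U = 1)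
    (h0 : ∀ U', U' ≠ U → m U' = 0) : G ⧸ U ≃ multiCoset m :=
  Equiv.ofBijective (fun x => ⟨U, ⟨0, by omega⟩, x⟩) (by
    constructor
    · intro x y h
      simpa using h
    · rintro ⟨U', ⟨k, hk⟩, x⟩
      have : U' = U := by
        by_contra h
        rw [h0 U' h] at hk
        omega
      subst this
      have : k = 0 := by omega
      subst this
      exact ⟨x, rfl⟩)

end Coset

/-! ### The isomorphism between ℚ[G/U₁] and ℚ[G/U₂] -/

variable {p : ℕ} [Fact p.Prime]

/-- The maps between the two coset representations. -/
theorem exists_coset_map {s : (ZMod p)ˣ} (hs : ¬ IsSquare (s : ZMod p)) {i j : Fin 2}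
    (hij : i ≠ j) (c : ℚ) :
    ∃ f : MonoidAlgebra ℚ (GL2 p ⧸ borelSquare p i) →ₗ[ℚ]
        MonoidAlgebra ℚ (GL2 p ⧸ borelSquare p j),
      (∀ g x, f (ofMulAction ℚ (GL2 p) _ g x) = ofMulAction ℚ (GL2 p) _ g (f x)) ∧
      f (cosetGen _) = (1 / 2 : ℚ) • ((cosetGen _ +
          ofMulAction ℚ (GL2 p) _ (upperTri s s 0) (cosetGen (borelSquare p j))) +
        c • weylSum (ofMulAction ℚ (GL2 p) _) (cosetGen _ -
          ofMulAction ℚ (GL2 p) _ (upperTri s s 0) (cosetGen (borelSquare p j)))) := by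
  refine exists_cosetGen_map _ (Submodule.smul_mem _ _ (add_mem ?_ (Submodule.smul_mem _ _ ?_)))
  · exact fixedSpace_borel_le i (add_scalar_mem (cosetGen_mem _) hs)
  · exact quadEigen_le i (weylSum_mem hij.symm (sub_scalar_mem (cosetGen_mem _) hs))

/-- Split the base point e into halves of e + z e and e - z e, with z the nonsquare scalar. The maps
match the plus parts, and send the minus parts to c T and d T of each other, so the composite is 1
on the first and c d T² = c d p = 1 on the second. -/
theorem coset_map_comp (hp : p ≠ 2) {s : (ZMod p)ˣ} (hs : ¬ IsSquare (s : ZMod p)) {i j : Fin 2}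
    (hij : i ≠ j) {c d : ℚ} (hcd : c * d * p = 1)
    {f : MonoidAlgebra ℚ (GL2 p ⧸ borelSquare p i) →ₗ[ℚ]
        MonoidAlgebra ℚ (GL2 p ⧸ borelSquare p j)}
    (hf : ∀ g x, f (ofMulAction ℚ (GL2 p) _ g x) = ofMulAction ℚ (GL2 p) _ g (f x))
    (hf1 : f (cosetGen _) = (1 / 2 : ℚ) • ((cosetGen _ +
          ofMulAction ℚ (GL2 p) _ (upperTri s s 0) (cosetGen (borelSquare p j))) +
        c • weylSum (ofMulAction ℚ (GL2 p) _) (cosetGen _ -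
          ofMulAction ℚ (GL2 p) _ (upperTri s s 0) (cosetGen (borelSquare p j)))))
    {f' : MonoidAlgebra ℚ (GL2 p ⧸ borelSquare p j) →ₗ[ℚ]
        MonoidAlgebra ℚ (GL2 p ⧸ borelSquare p i)}
    (hf' : ∀ g x, f' (ofMulAction ℚ (GL2 p) _ g x) = ofMulAction ℚ (GL2 p) _ g (f' x))
    (hf1' : f' (cosetGen _) = (1 / 2 : ℚ) • ((cosetGen _ +
          ofMulAction ℚ (GL2 p) _ (upperTri s s 0) (cosetGen (borelSquare p i))) +
        d • weylSum (ofMulAction ℚ (GL2 p) _) (cosetGen _ -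
          ofMulAction ℚ (GL2 p) _ (upperTri s s 0) (cosetGen (borelSquare p i))))) :
    f' ∘ₗ f = LinearMap.id := by
  apply eq_id_of_cosetGen
  · intro g x
    rw [LinearMap.comp_apply, hf, hf', LinearMap.comp_apply]
  set e := cosetGen (borelSquare p i)
  set e' := cosetGen (borelSquare p j)
  set σ := ofMulAction ℚ (GL2 p) (GL2 p ⧸ borelSquare p i)
  set τ := ofMulAction ℚ (GL2 p) (GL2 p ⧸ borelSquare p j)
  set z : GL2 p := upperTri s s 0
  have hT : ∀ x, f' (weylSum τ x) = weylSum σ (f' x) := by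
    intro x
    rw [weylSum_apply, weylSum_apply, map_sum]
    exact Finset.sum_congr rfl fun y _ => hf' _ _
  have hB : σ z (e + σ z e) = e + σ z e :=
    mem_fixedSpace.mp (add_scalar_mem (cosetGen_mem _) hs) z (upperTri_mem _ _ _)
  have hE : e - σ z e ∈ quadEigen σ i := sub_scalar_mem (cosetGen_mem _) hs
  have hTE : σ z (weylSum σ (e - σ z e)) = -weylSum σ (e - σ z e) :=
    scalar_apply_of_mem_quadEigen (weylSum_mem hij hE) hs
  have hadd : f' (e' + τ z e') = e + σ z e := by
    rw [map_add, hf', hf1', map_smul, map_add, map_smul, hB, hTE]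
    module
  have hsub : f' (e' - τ z e') = d • weylSum σ (e - σ z e) := by
    rw [map_sub, hf', hf1', map_smul, map_add, map_smul, hB, hTE]
    module
  rw [LinearMap.comp_apply, hf1, map_smul, map_add, map_smul, hT, hadd, hsub, map_smul,
    weylSum_weylSum hp hE, smul_smul, smul_smul, hcd]
  module

theorem nonempty_coset_equiv (hp : p ≠ 2) {i j : Fin 2} (hij : i ≠ j) :
    Nonempty ((ofMulAction ℚ (GL2 p) (GL2 p ⧸ borelSquare p i)).Equiv
      (ofMulAction ℚ (GL2 p) (GL2 p ⧸ borelSquare p j))) := by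
  have hp0 : (p : ℚ) ≠ 0 := Nat.cast_ne_zero.mpr (Fact.out : p.Prime).ne_zero
  obtain ⟨s, hs⟩ := exists_unit_nonsquare hp
  -- Any c and d with c d p = 1 would do; here they are 1 and p⁻¹.
  obtain ⟨f, hf, hf1⟩ := exists_coset_map hs hij 1
  obtain ⟨f', hf', hf1'⟩ := exists_coset_map hs hij.symm (p : ℚ)⁻¹
  have h1 := coset_map_comp hp hs hij (by field_simp) hf hf1 hf' hf1'
  have h2 := coset_map_comp hp hs hij.symm (by field_simp) hf' hf1' hf hf1
  exact ⟨.mk (LinearEquiv.ofLinearMap f f' h2 h1) fun g => LinearMap.ext fun x => hf g x⟩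

/-- Isomorphic permutation representations have equal dimension, so the two subgroups have the same
index. -/
theorem card_borelSquare (hp : p ≠ 2) {i j : Fin 2} (hij : i ≠ j) :
    Nat.card (borelSquare p i) = Nat.card (borelSquare p j) := by
  obtain ⟨φ⟩ := nonempty_coset_equiv hp hij
  have := Fintype.ofFinite (GL2 p ⧸ borelSquare p i)
  have := Fintype.ofFinite (GL2 p ⧸ borelSquare p j)
  have e := ((MonoidAlgebra.coeffLinearEquiv ℚ).symm.trans φ.toLinearEquiv).trans
    (MonoidAlgebra.coeffLinearEquiv ℚ)
  have h1 := e.finrank_eq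
  rw [Module.finrank_finsupp_self, Module.finrank_finsupp_self, ← Nat.card_eq_fintype_card,
    ← Nat.card_eq_fintype_card] at h1
  have h2 := (borelSquare p i).card_eq_card_quotient_mul_card_subgroup
  rw [(borelSquare p j).card_eq_card_quotient_mul_card_subgroup, h1] at h2
  exact (Nat.eq_of_mul_eq_mul_left Nat.card_pos h2).symm

theorem borelSquare_ne (hp : p ≠ 2) : U1 p ≠ U2 p := by
  obtain ⟨s, hs⟩ := exists_unit_nonsquare hp
  intro h
  have h1 : upperTri s 1 0 ∈ U1 p := ⟨upperTri_mem _ _ _, by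
    rw [coe_upperTri]; exact ⟨1, by simp⟩⟩
  rw [h] at h1
  exact hs h1.2

/-- As U₁ ≠ U₂, nothing cancels in Θ, and its positive and negative parts are single coset spaces.
-/
theorem isGRelation_gassmanTheta (hp : p ≠ 2) : IsGRelation (gassmanTheta p) := by
  have hne := borelSquare_ne hp
  obtain ⟨φ⟩ := nonempty_coset_equiv hp (i := 1) (j := 0) (by decide)
  let e1 : GL2 p ⧸ U1 p ≃ multiCoset fun U => (gassmanTheta p U).toNat :=
    multiCosetEquiv (by simp [gassmanTheta, hne.symm])
      (fun U hU => by
        classical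
        simp only [gassmanTheta, Finsupp.sub_apply, Finsupp.single_apply, hU.symm, if_false]
        split_ifs <;> simp)
  let e2 : GL2 p ⧸ U2 p ≃ multiCoset fun U => (-gassmanTheta p U).toNat :=
    multiCosetEquiv (by simp [gassmanTheta, hne])
      (fun U hU => by
        classical
        simp only [gassmanTheta, Finsupp.sub_apply, Finsupp.single_apply, hU.symm, if_false]
        split_ifs <;> simp)
  exact ⟨((ofMulActionEquiv e1 fun _ _ => rfl).symm.trans φ).trans
    (ofMulActionEquiv e2 fun _ _ => rfl)⟩

end Relation

end

/-! ### The regulator constant of Θ -/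

theorem mainTheorem5 (p : ℕ) [Fact p.Prime] (hp : p ≠ 2) :
    IsGRelation (gassmanTheta p) ∧
    ∀ (V : Type*) [AddCommGroup V] [Module ℚ V] [FiniteDimensional ℚ V]
      (ρ : Representation ℚ (GL2 p) V), ρ.IsIrreducible →
      ∀ B : InvariantPairing ρ,
        (Nonempty (ρ.Equiv (principalI p)) →
          regulatorConstant (gassmanTheta p) B = primeClass p) ∧
        (¬ Nonempty (ρ.Equiv (principalI p)) →
          regulatorConstant (gassmanTheta p) B = 1) := by
  refine ⟨isGRelation_gassmanTheta hp, ?_⟩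
  intro V _ _ _ ρ hρ B
  have hconst : regulatorConstant (gassmanTheta p) B =
      primeClass p ^ Module.finrank ℚ (quadEigen ρ 0) := by
    classical
    have h1 : gassmanTheta p = Finsupp.single (U1 p) 1 + Finsupp.single (U2 p) (-1) := by
      rw [gassmanTheta, sub_eq_add_neg, Finsupp.single_neg]
    -- U₁ has index 1 and U₂ index 0, so the class of U₁ is that of U₂ times a power of p, and the
    -- class of U₂ cancels.
    rw [regulatorConstant, h1, Finsupp.prod_add_index' (by simp) (by intros; rw [zpow_add]),
      Finsupp.prod_single_index (by simp), Finsupp.prod_single_index (by simp),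
      regulatorClass_eq_pow_mul hp B (i := 0) (j := 1) (by decide)
        (card_borelSquare hp (by decide))]
    rw [zpow_one, zpow_neg_one, mul_inv_cancel_right]
  rw [hconst]
  constructor
  · intro h
    rw [finrank_quadEigen_zero hp hρ ((nonempty_equiv_principalI_iff hp hρ).mp h), pow_one]
  · intro h
    rw [nonempty_equiv_principalI_iff hp hρ, not_not] at h
    rw [h, finrank_bot, pow_zero]
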